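/- For $n,k\ge 1$ put $H_n=\sum_{j=1}^n \frac1j$, $\zeta_n(k)=\sum_{j=1}^n \frac1{j^k}$ and $L_n(k)=\sum_{j=1}^n \frac{(-1)^{j-1}}{j^k}$. A *linear sum* of weight $p+q$ is one of the convergent series $$\sum_{n\ge1}\frac{\zeta_n(p)}{n^q},\quad \sum_{n\ge1}\frac{(-1)^{n-1}\zeta_n(p)}{n^q},\quad \sum_{n\ge1}\frac{L_n(p)}{n^q},\quad \sum_{n\ge1}\frac{(-1)^{n-1}L_n(p)}{n^q}\qquad (p\ge1,\ q\ge2).$$ Give $\ln 2$ weight $1$ and $\zeta(k)$ (for $k\ge2$) weight $k$. Say that a real number is *reducible to linear sums in weight $w$* if it is a linear combination with rational coefficients of (possibly empty) products of factors $\ln 2$ and $\zeta(k)$, $k\ge2$, of total weight $w$, and of products of one such monomial of weight $u$ with a single linear sum of weight $v$, where $u+v=w$. **Theorem.** For every integer $m\ge1$, the seven quadratic sums $$\sum_{n\ge1}\frac{L_n(1)^2}{n^{2m}}(-1)^{n-1},\quad \sum_{n\ge1}\frac{H_nL_n(1)}{n^{2m}},\quad \sum_{n\ge1}\frac{H_nL_n(1)}{n^{2m}}(-1)^{n-1},\quad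 \sum_{n\ge1}\frac{H_n^2}{n^{2m}},$$ $$\sum_{n\ge1}\frac{H_n^2}{n^{2m}}(-1)^{n-1},\quad \sum_{n\ge1}\frac{L_n(1)^2}{n^{2m}},\quad \sum_{n\ge1}\frac{H_n^2}{(2n+1)^{2m}}$$ converge, and each of them is reducible to linear sums in weight $2m+2$. -/

import Mathlib

/-- The generalized harmonic number `ζ_n(k) = ∑_{j=1}^n 1 / j^k`. -/
noncomputable def genHarmonic (k n : ℕ) : ℝ :=
  ∑ j ∈ Finset.range n, 1 / ((j : ℝ) + 1) ^ k

/-- The alternating harmonic number `L_n(k) = ∑_{j=1}^n (-1)^(j-1) / j^k`. -/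
noncomputable def altHarmonic (k n : ℕ) : ℝ :=
  ∑ j ∈ Finset.range n, (-1 : ℝ) ^ j / ((j : ℝ) + 1) ^ k

/-- `ζ_n(1)` is the harmonic number `H_n`. -/
theorem genHarmonic_one (n : ℕ) : genHarmonic 1 n = (harmonic n : ℝ) := by
  simp [genHarmonic, harmonic]

/-- The zeta value `ζ(k) = ∑_{n ≥ 1} 1 / n^k` (used for `k ≥ 2`), as a real number. -/
noncomputable def zetaValue (k : ℕ) : ℝ :=
  ∑' n : ℕ, 1 / ((n : ℝ) + 1) ^ k

/-- `zetaValue` agrees with Mathlib's Riemann zeta function. -/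
theorem ofReal_zetaValue {k : ℕ} (hk : 2 ≤ k) : (zetaValue k : ℂ) = riemannZeta k := by
  have h : 1 < (k : ℂ).re := by
    rw [Complex.natCast_re]
    exact_mod_cast (by omega : 1 < k)
  rw [zeta_eq_tsum_one_div_nat_add_one_cpow h, zetaValue, Complex.ofReal_tsum]
  refine tsum_congr fun n => ?_
  rw [Complex.cpow_natCast]
  push_cast
  rfl

/-- `IsLinearSum w s`: the real number `s` is one of the four kinds of (convergent) linear
double Euler sums of weight `w = p + q`, where `p ≥ 1` and `q ≥ 2`:
`∑ ζ_n(p) / n^q`, `∑ (-1)^(n-1) ζ_n(p) / n^q`, `∑ L_n(p) / n^q`, `∑ (-1)^(n-1) L_n(p) / n^q`.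
The index `n ≥ 1` of the series is written `n + 1` with `n : ℕ`. -/
inductive IsLinearSum : ℕ → ℝ → Prop
  | harm (p q : ℕ) (hp : 1 ≤ p) (hq : 2 ≤ q) :
      IsLinearSum (p + q) (∑' n : ℕ, genHarmonic p (n + 1) / ((n : ℝ) + 1) ^ q)
  | harmAlt (p q : ℕ) (hp : 1 ≤ p) (hq : 2 ≤ q) :
      IsLinearSum (p + q) (∑' n : ℕ, (-1 : ℝ) ^ n * genHarmonic p (n + 1) / ((n : ℝ) + 1) ^ q)
  | alt (p q : ℕ) (hp : 1 ≤ p) (hq : 2 ≤ q) :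
      IsLinearSum (p + q) (∑' n : ℕ, altHarmonic p (n + 1) / ((n : ℝ) + 1) ^ q)
  | altAlt (p q : ℕ) (hp : 1 ≤ p) (hq : 2 ≤ q) :
      IsLinearSum (p + q) (∑' n : ℕ, (-1 : ℝ) ^ n * altHarmonic p (n + 1) / ((n : ℝ) + 1) ^ q)

/-- `IsZetaLogMonomial w x`: the real number `x` is a (possibly empty) product of factors
`ln 2` (of weight `1`) and `ζ(k)`, `k ≥ 2` (of weight `k`), of total weight `w`. -/
inductive IsZetaLogMonomial : ℕ → ℝ → Prop
  | one : IsZetaLogMonomial 0 1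
  | mul_log {w : ℕ} {x : ℝ} (hx : IsZetaLogMonomial w x) :
      IsZetaLogMonomial (w + 1) (x * Real.log 2)
  | mul_zeta {w : ℕ} {x : ℝ} (k : ℕ) (hk : 2 ≤ k) (hx : IsZetaLogMonomial w x) :
      IsZetaLogMonomial (w + k) (x * zetaValue k)

/-- The real numbers that are reducible to linear sums in weight `w`: the rational linear
combinations of monomials of weight `w` in `ln 2` and zeta values, and of products of such a
monomial of weight `u` with a single linear sum of weight `v`, where `u + v = w`. -/
noncomputable def reducibleToLinearSums (w : ℕ) : Submodule ℚ ℝ :=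
  Submodule.span ℚ
    ({x | IsZetaLogMonomial w x} ∪
      {x | ∃ (u v : ℕ) (a s : ℝ),
        u + v = w ∧ IsZetaLogMonomial u a ∧ IsLinearSum v s ∧ x = a * s})

/-- The series `∑_{n ≥ 1} f n` converges, and its sum is reducible to linear sums in
weight `w`. -/
def SeriesReducible (w : ℕ) (f : ℕ → ℝ) : Prop :=
  ∃ S ∈ reducibleToLinearSums w, HasSum (fun n : ℕ => f (n + 1)) S

/-!
Sum the residues of `K_σ(s) K_τ(s) T_γ(s) / s ^ q` over all integers. Here `σ`, `τ`, `γ` are signs,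
`K_ε(s) = ∑_{k ≥ 1} ε ^ k (1 / (k - s) - 1 / k)` is a digamma function twisted by `ε`, and
`T_ε(s) = ∑_{k ≠ 0} ε ^ k / (k - s)` is a cotangent or a cosecant up to the term `1 / s`. Truncating
the kernels to finitely many poles turns the vanishing of this sum into a partial fraction identity,
and dominated convergence, with powers of `H_n` as bounds, removes the truncation.

The residue at `0` is a Taylor coefficient of `K_σ K_τ T_γ`, a polynomial in zeta values that is
homogeneous of weight `q + 2`. For even `q` the residues at `n` and `-n` add up to twice
`(σ τ γ) ^ n S_σ(n) S_τ(n) / n ^ q`, where `S_ε(n) = ∑_{j ≤ n} ε ^ j / j`, plus terms linear in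
harmonic numbers. As `γ` is arbitrary, this reduces all the sums with denominator `n ^ q`. Finally
`S_1(2 n + 1) + S_{-1}(2 n + 1) = H_n`, so the sum over `(2 n + 1) ^ q` is the odd part of a
combination of the others.
-/

open Filter Finset Topology

/-! ### Partial fractions of products of polar sums -/

/-- The Laurent data at `k` of a function `res / (k - s) + val + slope * (s - k) + ⋯` with at most
a simple pole there. -/
structure LaurentJet (R : Type*) where
  res : R
  val : R
  slope : R

namespace LaurentJet

variable {R : Type*} [CommRing R] (f g h : LaurentJet R)

/-- The coefficient of `1 / (k - s)` in the product of three Laurent expansions. -/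
def simplePart : R :=
  f.res * g.val * h.val + g.res * f.val * h.val + h.res * f.val * g.val
    - (f.res * g.res * h.slope + f.res * h.res * g.slope + g.res * h.res * f.slope)

/-- The coefficient of `1 / (k - s) ^ 2` in the product of three Laurent expansions. -/
def doublePart : R :=
  f.res * g.res * h.val + f.res * h.res * g.val + g.res * h.res * f.val

/-- The coefficient of `1 / (k - s) ^ 3` in the product of three Laurent expansions. -/
def triplePart : R := f.res * g.res * h.res

/-- The image of Laurent data under a ring homomorphism. -/
def map {S : Type*} [CommRing S] (φ : R →+* S) (f : LaurentJet R) : LaurentJet S :=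
  ⟨φ f.res, φ f.val, φ f.slope⟩

variable {S : Type*} [CommRing S] (φ : R →+* S)

theorem simplePart_map :
    (f.map φ).simplePart (g.map φ) (h.map φ) = φ (f.simplePart g h) := by
  simp only [simplePart, map, map_add, map_sub, map_mul]

theorem doublePart_map :
    (f.map φ).doublePart (g.map φ) (h.map φ) = φ (f.doublePart g h) := by
  simp only [doublePart, map, map_add, map_mul]

theorem triplePart_map :
    (f.map φ).triplePart (g.map φ) (h.map φ) = φ (f.triplePart g h) := by
  simp only [triplePart, map, map_mul]

end LaurentJet

/-- A constant plus a linear combination of formal simple fractions, one for each index. -/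
structure PolarSum (R ι : Type*) where
  const : R
  residue : ι → R

/-- The elements `E k` multiply like the simple fractions `1 / (k - s)`, with `d k l` in the role of
`1 / (l - k)`. The junk value `d k k = 0` removes the singular term from `∑ l, c l * d k l`. -/
structure IsSimpleFractionSystem {R ι : Type*} [CommRing R] (K : Finset ι) (E : ι → R)
    (d : ι → ι → R) : Prop where
  diag : ∀ k, d k k = 0
  mul : ∀ k ∈ K, ∀ l ∈ K, k ≠ l → E k * E l = E k * d k l + E l * d l k

theorem IsSimpleFractionSystem.map {R S ι : Type*} [CommRing R] [CommRing S] {K : Finset ι}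
    {E : ι → R} {d : ι → ι → R} (hE : IsSimpleFractionSystem K E d) (φ : R →+* S) :
    IsSimpleFractionSystem K (fun k => φ (E k)) fun k l => φ (d k l) where
  diag k := by rw [hE.diag, map_zero]
  mul k hk l hl hkl := by simp only [← map_mul, ← map_add, hE.mul k hk l hl hkl]

namespace PolarSum

variable {R ι : Type*} [CommRing R]

/-- The value of a polar sum with poles in `K` at a point where the simple fractions take the
values `E`. -/
def eval (f : PolarSum R ι) (K : Finset ι) (E : ι → R) : R :=
  f.const + ∑ k ∈ K, f.residue k * E k

/-- The derivative of a polar sum with poles in `K` at a point where the simple fractions take the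
values `E`. -/
def slope (f : PolarSum R ι) (K : Finset ι) (E : ι → R) : R :=
  ∑ k ∈ K, f.residue k * E k ^ 2

/-- The Laurent data of a polar sum with poles in `K` at the pole `k`. -/
def jet (f : PolarSum R ι) (K : Finset ι) (d : ι → ι → R) (k : ι) : LaurentJet R :=
  ⟨f.residue k, f.eval K (d k), f.slope K (d k)⟩

/-- The image of a polar sum under a ring homomorphism. -/
def map {S : Type*} [CommRing S] (φ : R →+* S) (f : PolarSum R ι) : PolarSum S ι :=
  ⟨φ f.const, fun k => φ (f.residue k)⟩

theorem jet_map {S : Type*} [CommRing S] (φ : R →+* S) (f : PolarSum R ι) (K : Finset ι)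
    (d : ι → ι → R) (k : ι) :
    (f.map φ).jet K (fun k l => φ (d k l)) k = (f.jet K d k).map φ := by
  simp only [jet, map, LaurentJet.map, eval, slope, map_add, map_sum, map_mul, map_pow]

variable {K : Finset ι} {E : ι → R} {d : ι → ι → R}

theorem simpleFraction_mul_eval (f : PolarSum R ι) (hE : IsSimpleFractionSystem K E d) {k : ι}
    (hk : k ∈ K) :
    E k * f.eval K E = E k * f.eval K (d k) + ∑ l ∈ K, f.residue l * d l k * E l
      + f.residue k * E k ^ 2 := by
  classical
  have term : ∀ l ∈ K, E k * (f.residue l * E l) = E k * (f.residue l * d k l)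
      + f.residue l * d l k * E l + if k = l then f.residue k * E k ^ 2 else 0 := by
    intro l hl
    split_ifs with hkl
    · subst hkl
      rw [hE.diag]
      ring
    · linear_combination f.residue l * hE.mul k hk l hl hkl
  simp only [eval, mul_add, mul_sum]
  rw [sum_congr rfl term, sum_add_distrib, sum_add_distrib, sum_ite_eq, if_pos hk]
  ring

theorem simpleFraction_sq_mul_eval (f : PolarSum R ι) (hE : IsSimpleFractionSystem K E d)
    (anti : ∀ k l, d k l = -d l k) {k : ι} (hk : k ∈ K) :
    E k ^ 2 * f.eval K E = E k ^ 2 * f.eval K (d k) - E k * f.slope K (d k)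
      + ∑ l ∈ K, f.residue l * d l k ^ 2 * E l + f.residue k * E k ^ 3 := by
  have cross := simpleFraction_mul_eval ⟨0, fun l => f.residue l * d l k⟩ hE hk
  have slope_eq : ∑ l ∈ K, f.residue l * d l k * d k l = -f.slope K (d k) := by
    rw [slope, ← sum_neg_distrib]
    exact sum_congr rfl fun l _ => by rw [anti l k]; ring
  simp only [eval, zero_add, slope_eq, hE.diag, mul_zero, zero_mul, add_zero] at cross
  have square : ∑ l ∈ K, f.residue l * d l k * d l k * E l
      = ∑ l ∈ K, f.residue l * d l k ^ 2 * E l := sum_congr rfl fun l _ => by ring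
  rw [square] at cross
  linear_combination E k * simpleFraction_mul_eval f hE hk + cross

theorem eval_mul_eval (f g : PolarSum R ι) (hE : IsSimpleFractionSystem K E d) :
    f.eval K E * g.eval K E = f.const * g.const
      + ∑ k ∈ K, (E k * (f.residue k * g.eval K (d k) + g.residue k * f.eval K (d k))
        + E k ^ 2 * (f.residue k * g.residue k)) := by
  have swap : ∑ k ∈ K, f.residue k * ∑ l ∈ K, g.residue l * d l k * E l
      = ∑ k ∈ K, g.residue k * E k * ∑ l ∈ K, f.residue l * d k l := by
    simp only [mul_sum]
    rw [sum_comm]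
    exact sum_congr rfl fun k _ => sum_congr rfl fun l _ => by ring
  calc f.eval K E * g.eval K E
      = f.const * g.eval K E + ∑ k ∈ K, f.residue k * (E k * g.eval K E) := by
        rw [eval, add_mul, sum_mul]
        simp only [mul_assoc]
    _ = f.const * g.eval K E
        + (∑ k ∈ K, (E k * (f.residue k * g.eval K (d k)) + E k ^ 2 * (f.residue k * g.residue k))
          + ∑ k ∈ K, f.residue k * ∑ l ∈ K, g.residue l * d l k * E l) := by
        rw [← sum_add_distrib]
        exact congrArg _ (sum_congr rfl fun k hk => by rw [simpleFraction_mul_eval g hE hk]; ring)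
    _ = _ := by
        rw [swap, eval, mul_add, mul_sum, add_assoc, ← sum_add_distrib, ← sum_add_distrib]
        refine congrArg _ (sum_congr rfl fun k _ => ?_)
        rw [eval, eval]
        ring

variable [DecidableEq ι]

theorem eval_erase (f : PolarSum R ι) (K : Finset ι) (E : ι → R) {l : ι} (hl : l ∈ K) :
    f.eval (K.erase l) E = f.eval K E - f.residue l * E l := by
  rw [eval, eval, ← add_sum_erase K _ hl]
  ring

theorem regularPart_eval_mul_eval (f g : PolarSum R ι)
    (anti : ∀ k l, d k l = -d l k)
    (cycle : ∀ l, IsSimpleFractionSystem (K.erase l) (d l) d) {l : ι} (hl : l ∈ K) :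
    f.const * g.const
        + ∑ k ∈ K, (d l k * (f.residue k * g.eval K (d k) + g.residue k * f.eval K (d k))
          + d l k ^ 2 * (f.residue k * g.residue k))
      = f.eval K (d l) * g.eval K (d l)
        - f.residue l * g.slope K (d l) - g.residue l * f.slope K (d l) := by
  have drop_diag : ∀ F : ι → R, F l = 0 → ∑ k ∈ K.erase l, F k = ∑ k ∈ K, F k := fun F hF => by
    rw [← add_sum_erase K F hl, hF, zero_add]
  have product := eval_mul_eval f g (cycle l)
  rw [eval_erase f K _ hl, eval_erase g K _ hl, (cycle l).diag, mul_zero, mul_zero, sub_zero,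
    sub_zero] at product
  rw [product, drop_diag _ (by simp only [(cycle l).diag]; ring), slope, slope, mul_sum, mul_sum,
    add_sub_assoc, add_sub_assoc, ← sum_sub_distrib, ← sum_sub_distrib]
  refine congrArg _ (sum_congr rfl fun k _ => ?_)
  rw [eval_erase f K _ hl, eval_erase g K _ hl, anti k l]
  ring

theorem eval_mul_eval_mul_eval (f g h : PolarSum R ι) (hE : IsSimpleFractionSystem K E d)
    (anti : ∀ k l, d k l = -d l k)
    (cycle : ∀ l, IsSimpleFractionSystem (K.erase l) (d l) d) :
    f.eval K E * g.eval K E * h.eval K E = f.const * g.const * h.const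
      + ∑ k ∈ K, (E k * LaurentJet.simplePart (f.jet K d k) (g.jet K d k) (h.jet K d k)
        + E k ^ 2 * LaurentJet.doublePart (f.jet K d k) (g.jet K d k) (h.jet K d k)
        + E k ^ 3 * LaurentJet.triplePart (f.jet K d k) (g.jet K d k) (h.jet K d k)) := by
  set u : ι → R := fun k => f.residue k * g.eval K (d k) + g.residue k * f.eval K (d k)
  set v : ι → R := fun k => f.residue k * g.residue k
  have term : ∀ k ∈ K, (E k * u k + E k ^ 2 * v k) * h.eval K E
      = E k * (u k * h.eval K (d k) - v k * h.slope K (d k))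
        + E k ^ 2 * (u k * h.residue k + v k * h.eval K (d k)) + E k ^ 3 * (v k * h.residue k)
        + ∑ l ∈ K, h.residue l * E l * (d l k * u k + d l k ^ 2 * v k) := by
    intro k hk
    have split : ∑ l ∈ K, h.residue l * E l * (d l k * u k + d l k ^ 2 * v k)
        = u k * ∑ l ∈ K, h.residue l * d l k * E l
          + v k * ∑ l ∈ K, h.residue l * d l k ^ 2 * E l := by
      rw [mul_sum, mul_sum, ← sum_add_distrib]
      exact sum_congr rfl fun l _ => by ring
    linear_combination u k * simpleFraction_mul_eval h hE hk
      + v k * simpleFraction_sq_mul_eval h hE anti hk - split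
  have cross : ∑ k ∈ K, ∑ l ∈ K, h.residue l * E l * (d l k * u k + d l k ^ 2 * v k)
      = ∑ l ∈ K, h.residue l * E l * (f.eval K (d l) * g.eval K (d l)
        - f.residue l * g.slope K (d l) - g.residue l * f.slope K (d l) - f.const * g.const) := by
    rw [sum_comm]
    refine sum_congr rfl fun l hl => ?_
    rw [← mul_sum, ← regularPart_eval_mul_eval f g anti cycle hl, add_sub_cancel_left]
  rw [eval_mul_eval f g hE, add_mul, sum_mul, sum_congr rfl term, sum_add_distrib, cross, eval,
    mul_add, mul_sum, add_assoc, ← sum_add_distrib, ← sum_add_distrib]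
  refine congrArg _ (sum_congr rfl fun k _ => ?_)
  simp only [LaurentJet.simplePart, LaurentJet.doublePart, LaurentJet.triplePart, jet, u, v, eval]
  ring

end PolarSum

/-- The simple fraction `1 / (k - z)` with pole at the integer `k` and junk value `0` at `z = k`. -/
noncomputable def poleFraction (z : ℤ) (k : ℤ) : ℝ := 1 / ((k : ℝ) - z)

/-- The Taylor series of `1 / (k - s)` at `s = 0`. -/
noncomputable def poleSeries (k : ℤ) : PowerSeries ℝ :=
  PowerSeries.mk fun j => 1 / (k : ℝ) ^ (j + 1)

theorem poleFraction_self (k : ℤ) : poleFraction k k = 0 := by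
  simp [poleFraction]

theorem poleFraction_antisymm (k l : ℤ) : poleFraction k l = -poleFraction l k := by
  rw [poleFraction, poleFraction, ← neg_sub, one_div_neg_eq_neg_one_div]

theorem isSimpleFractionSystem_poleFraction {K : Finset ℤ} {z : ℤ} (hz : z ∉ K) :
    IsSimpleFractionSystem K (poleFraction z) poleFraction where
  diag := poleFraction_self
  mul k hk l hl hkl := by
    have hkz : (k : ℝ) - z ≠ 0 := sub_ne_zero.2 (by exact_mod_cast ne_of_mem_of_not_mem hk hz)
    have hlz : (l : ℝ) - z ≠ 0 := sub_ne_zero.2 (by exact_mod_cast ne_of_mem_of_not_mem hl hz)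
    have hlk : (l : ℝ) - k ≠ 0 := sub_ne_zero.2 (by exact_mod_cast hkl.symm)
    rw [poleFraction_antisymm l k]
    simp only [poleFraction]
    field_simp
    ring

theorem poleSeries_mul_sub_X {k : ℤ} (hk : k ≠ 0) :
    poleSeries k * (PowerSeries.C (k : ℝ) - PowerSeries.X) = 1 := by
  have hk' : (k : ℝ) ≠ 0 := by exact_mod_cast hk
  have h : poleSeries k = PowerSeries.invUnitsSub (Units.mk0 (k : ℝ) hk') := by
    ext j
    simp [poleSeries]
  rw [h]
  exact PowerSeries.invUnitsSub_mul_sub (Units.mk0 (k : ℝ) hk')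

theorem isSimpleFractionSystem_poleSeries {K : Finset ℤ} (hK : 0 ∉ K) :
    IsSimpleFractionSystem K poleSeries fun k l => PowerSeries.C (poleFraction k l) where
  diag k := by rw [poleFraction_self, map_zero]
  mul k hk l hl hkl := by
    have hk := poleSeries_mul_sub_X (ne_of_mem_of_not_mem hk hK)
    have hl := poleSeries_mul_sub_X (ne_of_mem_of_not_mem hl hK)
    have hlk : PowerSeries.C (poleFraction k l) * (PowerSeries.C (l : ℝ) - PowerSeries.C (k : ℝ))
        = 1 := by
      rw [← map_sub, ← map_mul, poleFraction, one_div_mul_cancel, map_one]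
      exact sub_ne_zero.2 (by exact_mod_cast hkl.symm)
    rw [poleFraction_antisymm l k, map_neg]
    linear_combination (-poleSeries k * poleSeries l) * hlk
      + poleSeries k * PowerSeries.C (poleFraction k l) * hl
      - poleSeries l * PowerSeries.C (poleFraction k l) * hk

theorem coeff_poleSeries_pow (k : ℤ) (d t : ℕ) :
    PowerSeries.coeff t (poleSeries k ^ (d + 1)) = (d + t).choose d / (k : ℝ) ^ (t + d + 1) := by
  have h : poleSeries k = PowerSeries.C (1 / (k : ℝ)) *
      PowerSeries.rescale (1 / (k : ℝ)) (PowerSeries.mk 1) := by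
    ext j
    simp [poleSeries, PowerSeries.coeff_rescale, pow_succ, mul_comm]
  rw [h, mul_pow, ← map_pow, ← map_pow, PowerSeries.mk_one_pow_eq_mk_choose_add,
    PowerSeries.coeff_C_mul, PowerSeries.coeff_rescale, PowerSeries.coeff_mk]
  ring

/-- The residue at `s = k`, up to sign, of the product of three Laurent expansions at `k` divided by
`s ^ q`. -/
noncomputable def tripleResidue (q : ℕ) (k : ℝ) (f g h : LaurentJet ℝ) : ℝ :=
  f.simplePart g h / k ^ q + q * f.doublePart g h / k ^ (q + 1)
    + q * (q + 1) / 2 * f.triplePart g h / k ^ (q + 2)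

namespace PolarSum

/-- The Taylor series at `s = 0` of `const + ∑ k ∈ K, residue k / (k - s)`. -/
noncomputable def series (f : PolarSum ℝ ℤ) (K : Finset ℤ) : PowerSeries ℝ :=
  (f.map PowerSeries.C).eval K poleSeries

theorem coeff_series (f : PolarSum ℝ ℤ) (K : Finset ℤ) (j : ℕ) :
    PowerSeries.coeff j (f.series K) = (if j = 0 then f.const else 0)
      + ∑ k ∈ K, f.residue k * poleFraction 0 k ^ (j + 1) := by
  simp [series, eval, map, PowerSeries.coeff_C, poleSeries, poleFraction]

-- The residue theorem for the product of the three rational functions divided by `s ^ (t + 1)`, in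
-- the form of a comparison of Taylor coefficients at `0` in the partial fraction expansion.
theorem coeff_series_mul_series_mul_series (f g h : PolarSum ℝ ℤ) {K : Finset ℤ} (hK : 0 ∉ K)
    {t : ℕ} (ht : 1 ≤ t) :
    PowerSeries.coeff t (f.series K * g.series K * h.series K)
      = ∑ k ∈ K, tripleResidue (t + 1) k (f.jet K poleFraction k) (g.jet K poleFraction k)
          (h.jet K poleFraction k) := by
  have product := eval_mul_eval_mul_eval (f.map PowerSeries.C) (g.map PowerSeries.C)
    (h.map PowerSeries.C) (isSimpleFractionSystem_poleSeries hK)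
    (fun k l => by rw [poleFraction_antisymm, map_neg])
    (fun l => (isSimpleFractionSystem_poleFraction (notMem_erase l K)).map PowerSeries.C)
  have coeff_const : PowerSeries.coeff t ((f.map PowerSeries.C).const * (g.map PowerSeries.C).const
      * (h.map PowerSeries.C).const) = 0 := by
    simp only [map, ← map_mul, PowerSeries.coeff_C_of_ne_zero (Nat.ne_of_gt ht)]
  have choose_two : ((t + 2).choose 2 : ℝ) = (t + 1) * (t + 2) / 2 := by
    rw [Nat.cast_choose_two]
    push_cast
    ring
  rw [series, series, series, product, map_add, coeff_const, zero_add, map_sum]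
  refine sum_congr rfl fun k _ => ?_
  have simple := coeff_poleSeries_pow k 0 t
  have double := coeff_poleSeries_pow k 1 t
  have triple := coeff_poleSeries_pow k 2 t
  rw [zero_add, pow_one, Nat.choose_zero_right] at simple
  rw [add_comm 1 t, Nat.choose_one_right] at double
  rw [add_comm 2 t, choose_two] at triple
  simp only [jet_map, LaurentJet.simplePart_map, LaurentJet.doublePart_map,
    LaurentJet.triplePart_map, map_add, PowerSeries.coeff_mul_C, tripleResidue]
  rw [simple, double, triple]
  push_cast
  ring

end PolarSum

/-! ### Dominated convergence of residue sums -/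

theorem genHarmonic_succ (k n : ℕ) :
    genHarmonic k (n + 1) = genHarmonic k n + 1 / ((n : ℝ) + 1) ^ k := by
  rw [genHarmonic, sum_range_succ, genHarmonic]

theorem genHarmonic_nonneg (k n : ℕ) : 0 ≤ genHarmonic k n :=
  sum_nonneg fun j _ => by positivity

theorem genHarmonic_mono (k : ℕ) : Monotone (genHarmonic k) :=
  monotone_nat_of_le_succ fun n => by
    rw [genHarmonic_succ]
    exact le_add_of_nonneg_right (by positivity)

theorem one_le_genHarmonic (k : ℕ) {n : ℕ} (hn : 1 ≤ n) : 1 ≤ genHarmonic k n :=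
  calc (1 : ℝ) = genHarmonic k 1 := by simp [genHarmonic]
    _ ≤ _ := genHarmonic_mono k hn

theorem genHarmonic_one_le_rpow (n : ℕ) : genHarmonic 1 n ≤ 5 * (n : ℝ) ^ (1 / 4 : ℝ) := by
  rcases Nat.eq_zero_or_pos n with rfl | hn
  · simp [genHarmonic]
  have hn : (1 : ℝ) ≤ n := by exact_mod_cast hn
  have log_le := Real.log_le_rpow_div (x := (n : ℝ)) (by positivity) (ε := 1 / 4) (by norm_num)
  have harmonic_le := harmonic_le_one_add_log n
  have one_le : (1 : ℝ) ≤ (n : ℝ) ^ (1 / 4 : ℝ) := Real.one_le_rpow hn (by norm_num)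
  rw [genHarmonic_one]
  linarith

theorem summable_genHarmonic_sq_div_sq :
    Summable fun n : ℕ => genHarmonic 1 (n + 1) ^ 2 / ((n + 1 : ℕ) : ℝ) ^ 2 := by
  have dominating : Summable fun n : ℕ => 25 * (1 / ((n + 1 : ℕ) : ℝ) ^ (3 / 2 : ℝ)) :=
    ((summable_nat_add_iff 1).mpr
      (Real.summable_one_div_nat_rpow.mpr (by norm_num : (1 : ℝ) < 3 / 2))).mul_left 25
  refine Summable.of_nonneg_of_le (fun n => by positivity) (fun n => ?_) dominating
  have hx : (0 : ℝ) < ((n + 1 : ℕ) : ℝ) := by positivity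
  have sq_le := pow_le_pow_left₀ (genHarmonic_nonneg 1 (n + 1)) (genHarmonic_one_le_rpow (n + 1)) 2
  have split : (((n + 1 : ℕ) : ℝ) ^ (1 / 4 : ℝ)) ^ 2 * ((n + 1 : ℕ) : ℝ) ^ (3 / 2 : ℝ)
      = ((n + 1 : ℕ) : ℝ) ^ 2 := by
    rw [← Real.rpow_natCast, ← Real.rpow_natCast, ← Real.rpow_mul hx.le, ← Real.rpow_add hx]
    norm_num
  have hy : (0 : ℝ) < ((n + 1 : ℕ) : ℝ) ^ (3 / 2 : ℝ) := by positivity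
  rw [mul_one_div, div_le_div_iff₀ (by positivity) hy, ← split]
  nlinarith

/-- For every `n ≥ 1` the sequence `N ↦ u N n` converges to `v n`, and on `1 ≤ n ≤ N` it is bounded
by a multiple of `H_n ^ d`. For `d ≤ 2` these are hypotheses under which
`∑ n ∈ [1, N], u N n / n ^ 2` converges to `∑ n, v n / n ^ 2` by dominated convergence. -/
structure HarmonicDominated (d : ℕ) (u : ℕ → ℕ → ℝ) (v : ℕ → ℝ) : Prop where
  tendsto : ∀ n, 1 ≤ n → Tendsto (fun N => u N n) atTop (𝓝 (v n))
  bound : ∃ C, ∀ N n, 1 ≤ n → n ≤ N → |u N n| ≤ C * genHarmonic 1 n ^ d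

namespace HarmonicDominated

variable {d e : ℕ} {u u' : ℕ → ℕ → ℝ} {v v' : ℕ → ℝ}

theorem of_bounded {v : ℕ → ℝ} {C : ℝ} (h : ∀ n, 1 ≤ n → |v n| ≤ C) :
    HarmonicDominated 0 (fun _ => v) v :=
  ⟨fun _ _ => tendsto_const_nhds, C, fun _ n hn _ => by simpa using h n hn⟩

theorem sq_div_pow {k : ℕ} (hk : 2 ≤ k) {s : ℝ} (hs : |s| = 1) :
    HarmonicDominated 0 (fun _ n => (n : ℝ) ^ 2 / (s * n) ^ k) fun n => (n : ℝ) ^ 2 / (s * n) ^ k :=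
  of_bounded (C := 1) fun n hn => by
    have hn : (1 : ℝ) ≤ n := by exact_mod_cast hn
    rw [abs_div, abs_pow, abs_pow, abs_mul, hs, one_mul, abs_of_nonneg (by positivity)]
    exact div_le_one_of_le₀ (pow_le_pow_right₀ hn hk) (by positivity)

theorem congr (h : HarmonicDominated d u v) (hu : ∀ N n, 1 ≤ n → n ≤ N → u N n = u' N n)
    (hv : ∀ n, 1 ≤ n → v n = v' n) : HarmonicDominated d u' v' := by
  obtain ⟨C, hC⟩ := h.bound
  refine ⟨fun n hn => ?_, C, fun N n hn hN => hu N n hn hN ▸ hC N n hn hN⟩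
  refine hv n hn ▸ (h.tendsto n hn).congr' ?_
  filter_upwards [eventually_ge_atTop n] with N hN using hu N n hn hN

theorem mono (h : HarmonicDominated d u v) (hde : d ≤ e) : HarmonicDominated e u v := by
  obtain ⟨C, hC⟩ := h.bound
  refine ⟨h.tendsto, |C|, fun N n hn hN => (hC N n hn hN).trans ?_⟩
  have := one_le_genHarmonic 1 hn
  gcongr
  exact le_abs_self C

theorem add (h : HarmonicDominated d u v) (h' : HarmonicDominated d u' v') :
    HarmonicDominated d (fun N n => u N n + u' N n) fun n => v n + v' n := by
  obtain ⟨C, hC⟩ := h.bound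
  obtain ⟨C', hC'⟩ := h'.bound
  refine ⟨fun n hn => (h.tendsto n hn).add (h'.tendsto n hn), C + C', fun N n hn hN => ?_⟩
  rw [add_mul]
  exact (abs_add_le _ _).trans (add_le_add (hC N n hn hN) (hC' N n hn hN))

theorem mul (h : HarmonicDominated d u v) (h' : HarmonicDominated e u' v') :
    HarmonicDominated (d + e) (fun N n => u N n * u' N n) fun n => v n * v' n := by
  obtain ⟨C, hC⟩ := h.bound
  obtain ⟨C', hC'⟩ := h'.bound
  refine ⟨fun n hn => (h.tendsto n hn).mul (h'.tendsto n hn), C * C', fun N n hn hN => ?_⟩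
  rw [abs_mul, pow_add, mul_mul_mul_comm]
  exact mul_le_mul (hC N n hn hN) (hC' N n hn hN) (abs_nonneg _)
    ((abs_nonneg _).trans (hC N n hn hN))

theorem const_mul (c : ℝ) (h : HarmonicDominated d u v) :
    HarmonicDominated d (fun N n => c * u N n) fun n => c * v n :=
  zero_add d ▸ (of_bounded (v := fun _ => c) fun _ _ => le_rfl).mul h

theorem sub (h : HarmonicDominated d u v) (h' : HarmonicDominated d u' v') :
    HarmonicDominated d (fun N n => u N n - u' N n) fun n => v n - v' n := by
  simpa only [sub_eq_add_neg, neg_one_mul] using h.add (h'.const_mul (-1))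

theorem summable
    (h : HarmonicDominated 2 (fun N n => (n : ℝ) ^ 2 * u N n) fun n => (n : ℝ) ^ 2 * v n) :
    Summable fun n => v (n + 1) := by
  obtain ⟨C, hC⟩ := h.bound
  refine (summable_genHarmonic_sq_div_sq.mul_left C).of_norm_bounded fun n => ?_
  have limit_le : |((n + 1 : ℕ) : ℝ) ^ 2 * v (n + 1)| ≤ C * genHarmonic 1 (n + 1) ^ 2 :=
    le_of_tendsto (h.tendsto (n + 1) n.succ_pos).abs
      ((eventually_ge_atTop (n + 1)).mono fun N hN => hC N (n + 1) n.succ_pos hN)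
  rw [abs_mul, abs_of_nonneg (by positivity), mul_comm] at limit_le
  rwa [← mul_div_assoc, le_div_iff₀ (by positivity)]

theorem hasSum
    (h : HarmonicDominated 2 (fun N n => (n : ℝ) ^ 2 * u N n) fun n => (n : ℝ) ^ 2 * v n)
    {L : ℝ} (hL : Tendsto (fun N => ∑ n ∈ range N, u N (n + 1)) atTop (𝓝 L)) :
    HasSum (fun n => v (n + 1)) L := by
  obtain ⟨C, hC⟩ := h.bound
  have hC0 : 0 ≤ C := by
    simpa [genHarmonic] using (abs_nonneg _).trans (hC 1 1 le_rfl le_rfl)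
  set truncated : ℕ → ℕ → ℝ := fun N n => if n < N then u N (n + 1) else 0
  have limit : ∀ n, Tendsto (fun N => truncated N n) atTop (𝓝 (v (n + 1))) := fun n => by
    have hn : ((n + 1 : ℕ) : ℝ) ^ 2 ≠ 0 := by positivity
    have cancelled := (h.tendsto (n + 1) n.succ_pos).const_mul (((n + 1 : ℕ) : ℝ) ^ 2)⁻¹
    simp only [inv_mul_cancel_left₀ hn] at cancelled
    exact cancelled.congr' ((eventually_gt_atTop n).mono fun N hN => (if_pos hN).symm)
  have truncated_le : ∀ N n, ‖truncated N n‖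
      ≤ C * (genHarmonic 1 (n + 1) ^ 2 / ((n + 1 : ℕ) : ℝ) ^ 2) := fun N n => by
    simp only [truncated]
    split_ifs with hn
    · have := hC N (n + 1) n.succ_pos hn
      rw [abs_mul, abs_of_nonneg (by positivity), mul_comm] at this
      rwa [← mul_div_assoc, le_div_iff₀ (by positivity)]
    · rw [norm_zero]
      positivity
  have exchange := tendsto_tsum_of_dominated_convergence
    (summable_genHarmonic_sq_div_sq.mul_left C) limit (Eventually.of_forall truncated_le)
  have finite_sum : ∀ N, ∑' n, truncated N n = ∑ n ∈ range N, u N (n + 1) := fun N => by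
    rw [tsum_eq_sum (s := range N) fun n hn => if_neg (by simpa using hn)]
    exact sum_congr rfl fun n hn => if_pos (mem_range.1 hn)
  simp only [finite_sum] at exchange
  exact tendsto_nhds_unique hL exchange ▸ h.summable.hasSum

end HarmonicDominated

/-- Convergence, with harmonic domination, of sequences of Laurent data. -/
structure JetDominated (f : ℕ → ℕ → LaurentJet ℝ) (g : ℕ → LaurentJet ℝ) :
    Prop where
  res : HarmonicDominated 0 (fun N n => (f N n).res) fun n => (g n).res
  val : HarmonicDominated 1 (fun N n => (f N n).val) fun n => (g n).val
  slope : HarmonicDominated 0 (fun N n => (f N n).slope) fun n => (g n).slope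

namespace JetDominated

variable {f₁ f₂ f₃ : ℕ → ℕ → LaurentJet ℝ} {g₁ g₂ g₃ : ℕ → LaurentJet ℝ}

theorem simplePart (h₁ : JetDominated f₁ g₁) (h₂ : JetDominated f₂ g₂)
    (h₃ : JetDominated f₃ g₃) :
    HarmonicDominated 2 (fun N n => (f₁ N n).simplePart (f₂ N n) (f₃ N n))
      fun n => (g₁ n).simplePart (g₂ n) (g₃ n) :=
  ((((h₁.res.mul h₂.val).mul h₃.val).add ((h₂.res.mul h₁.val).mul h₃.val)).add
    ((h₃.res.mul h₁.val).mul h₂.val)).sub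
    (((((h₁.res.mul h₂.res).mul h₃.slope).add ((h₁.res.mul h₃.res).mul h₂.slope)).add
      ((h₂.res.mul h₃.res).mul h₁.slope)).mono (Nat.zero_le 2))

theorem doublePart (h₁ : JetDominated f₁ g₁) (h₂ : JetDominated f₂ g₂)
    (h₃ : JetDominated f₃ g₃) :
    HarmonicDominated 1 (fun N n => (f₁ N n).doublePart (f₂ N n) (f₃ N n))
      fun n => (g₁ n).doublePart (g₂ n) (g₃ n) :=
  (((h₁.res.mul h₂.res).mul h₃.val).add ((h₁.res.mul h₃.res).mul h₂.val)).add
    ((h₂.res.mul h₃.res).mul h₁.val)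

theorem triplePart (h₁ : JetDominated f₁ g₁) (h₂ : JetDominated f₂ g₂)
    (h₃ : JetDominated f₃ g₃) :
    HarmonicDominated 0 (fun N n => (f₁ N n).triplePart (f₂ N n) (f₃ N n))
      fun n => (g₁ n).triplePart (g₂ n) (g₃ n) :=
  (h₁.res.mul h₂.res).mul h₃.res

theorem tripleResidue (h₁ : JetDominated f₁ g₁)
    (h₂ : JetDominated f₂ g₂) (h₃ : JetDominated f₃ g₃)
    {q : ℕ} (hq : 2 ≤ q) {s : ℝ} (hs : |s| = 1) :
    HarmonicDominated 2
      (fun N n => (n : ℝ) ^ 2 * tripleResidue q (s * n) (f₁ N n) (f₂ N n) (f₃ N n))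
      fun n => (n : ℝ) ^ 2 * tripleResidue q (s * n) (g₁ n) (g₂ n) (g₃ n) := by
  have simple := (h₁.simplePart h₂ h₃).mul (.sq_div_pow hq hs)
  have double := ((h₁.doublePart h₂ h₃).const_mul q).mul (.sq_div_pow (k := q + 1) (by omega) hs)
  have triple := ((h₁.triplePart h₂ h₃).const_mul (q * (q + 1) / 2)).mul
    (.sq_div_pow (k := q + 2) (by omega) hs)
  refine ((simple.add (double.mono one_le_two)).add (triple.mono (Nat.zero_le 2))).congr
    (fun N n _ _ => ?_) fun n _ => ?_ <;>
  · rw [_root_.tripleResidue]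
    ring

end JetDominated

/-- The nonzero integers of absolute value at most `N`. -/
noncomputable def punctured (N : ℕ) : Finset ℤ := (Icc (-(N : ℤ)) N).erase 0

theorem notMem_punctured (N : ℕ) : 0 ∉ punctured N := notMem_erase 0 _

theorem sum_punctured {M : Type*} [AddCommMonoid M] (f : ℤ → M) (N : ℕ) :
    ∑ k ∈ punctured N, f k = ∑ n ∈ range N, (f (n + 1 : ℕ) + f (-(n + 1 : ℕ))) := by
  induction N with
  | zero => simp [punctured]
  | succ N ih =>
    have insert_ends : punctured (N + 1)
        = insert ((N + 1 : ℕ) : ℤ) (insert (-((N + 1 : ℕ) : ℤ)) (punctured N)) := by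
      ext k
      simp only [punctured, mem_erase, mem_Icc, mem_insert]
      push_cast
      omega
    rw [insert_ends, sum_insert, sum_insert, ih, sum_range_succ, ← add_assoc, add_comm]
    · simp only [punctured, mem_erase, mem_Icc]
      omega
    · simp only [punctured, mem_erase, mem_Icc, mem_insert]
      omega

namespace PolarSum

/-- The truncations `f N`, with poles at the nonzero integers of absolute value at most `N`,
converge: the Laurent data at `n` to `pos n` and those at `-n` to `neg n`, both with harmonic
domination, and the Taylor coefficients at `0` to those of `F`. -/
structure TendstoKernel (f : ℕ → PolarSum ℝ ℤ) (pos neg : ℕ → LaurentJet ℝ) (F : PowerSeries ℝ) :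
    Prop where
  pos : JetDominated (fun N n => (f N).jet (punctured N) poleFraction n) pos
  neg : JetDominated (fun N n => (f N).jet (punctured N) poleFraction (-n)) neg
  coeff : ∀ j, Tendsto (fun N => PowerSeries.coeff j ((f N).series (punctured N))) atTop
    (𝓝 (PowerSeries.coeff j F))

open scoped PowerSeries.WithPiTopology in
theorem TendstoKernel.tendsto_series {f : ℕ → PolarSum ℝ ℤ} {pos neg : ℕ → LaurentJet ℝ}
    {F : PowerSeries ℝ} (hf : TendstoKernel f pos neg F) :
    Tendsto (fun N => (f N).series (punctured N)) atTop (𝓝 F) :=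
  (PowerSeries.WithPiTopology.tendsto_iff_coeff_tendsto ℝ _ _ _).2 hf.coeff

open scoped PowerSeries.WithPiTopology in
theorem hasSum_tripleResidue {f g h : ℕ → PolarSum ℝ ℤ}
    {fpos fneg gpos gneg hpos hneg : ℕ → LaurentJet ℝ}
    {F G H : PowerSeries ℝ} (hf : TendstoKernel f fpos fneg F) (hg : TendstoKernel g gpos gneg G)
    (hh : TendstoKernel h hpos hneg H) {t : ℕ} (ht : 1 ≤ t) :
    HasSum (fun n : ℕ =>
      tripleResidue (t + 1) (1 * (n + 1 : ℕ)) (fpos (n + 1)) (gpos (n + 1)) (hpos (n + 1))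
        + tripleResidue (t + 1) (-1 * (n + 1 : ℕ)) (fneg (n + 1)) (gneg (n + 1)) (hneg (n + 1)))
      (PowerSeries.coeff t (F * G * H)) := by
  have hq : 2 ≤ t + 1 := Nat.succ_le_succ ht
  have residues := (JetDominated.tripleResidue hf.pos hg.pos hh.pos hq abs_one).add
    (JetDominated.tripleResidue hf.neg hg.neg hh.neg hq (s := -1) (by simp))
  simp only [← mul_add] at residues
  refine residues.hasSum ?_
  have products := (hf.tendsto_series.mul hg.tendsto_series).mul hh.tendsto_series
  refine ((PowerSeries.WithPiTopology.tendsto_iff_coeff_tendsto ℝ _ _ _).1 products t).congr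
    fun N => ?_
  rw [coeff_series_mul_series_mul_series _ _ _ (notMem_punctured N) ht, sum_punctured]
  simp

end PolarSum

/-! ### Harmonic numbers twisted by a sign -/

/-- The character `k ↦ ε ^ k` of the integers attached to a sign `ε`, with values in `ℝ`. -/
noncomputable def signChar (ε : ℤˣ) (k : ℤ) : ℝ := ((ε ^ k : ℤˣ) : ℤ)

/-- The harmonic number `∑_{j=1}^n ε ^ j / j ^ k` attached to a sign `ε`. It is `ζ_n(k)` for `ε = 1`
and `-L_n(k)` for `ε = -1`. -/
noncomputable def signHarmonic (ε : ℤˣ) (k n : ℕ) : ℝ :=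
  ∑ j ∈ range n, signChar ε (j + 1 : ℕ) / ((j + 1 : ℕ) : ℝ) ^ k

/-- The limit `∑_{n ≥ 1} ε ^ n / n ^ k`, for `k ≥ 2`, of the harmonic numbers attached to a
sign `ε`. -/
noncomputable def signZeta (ε : ℤˣ) (k : ℕ) : ℝ :=
  ∑' n : ℕ, signChar ε (n + 1 : ℕ) / ((n + 1 : ℕ) : ℝ) ^ k

theorem signChar_one (k : ℤ) : signChar 1 k = 1 := by simp [signChar]

theorem signChar_neg_one (n : ℕ) : signChar (-1) n = (-1) ^ n := by simp [signChar]

theorem signChar_add (ε : ℤˣ) (k l : ℤ) : signChar ε (k + l) = signChar ε k * signChar ε l := by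
  simp [signChar, zpow_add]

theorem signChar_neg (ε : ℤˣ) (k : ℤ) : signChar ε (-k) = signChar ε k := by
  simp [signChar, Int.units_inv_eq_self]

theorem signChar_mul (δ ε : ℤˣ) (k : ℤ) : signChar (δ * ε) k = signChar δ k * signChar ε k := by
  simp [signChar, mul_zpow]

theorem signChar_mul_self (ε : ℤˣ) (k : ℤ) : signChar ε k * signChar ε k = 1 := by
  rw [← signChar_mul, Int.units_mul_self, signChar_one]

theorem abs_signChar (ε : ℤˣ) (k : ℤ) : |signChar ε k| = 1 := by
  rw [signChar, ← Int.cast_abs, Int.isUnit_iff_abs_eq.1 (ε ^ k).isUnit, Int.cast_one]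

theorem signHarmonic_one (k n : ℕ) : signHarmonic 1 k n = genHarmonic k n := by
  simp [signHarmonic, genHarmonic, signChar_one]

theorem signHarmonic_neg_one (k n : ℕ) : signHarmonic (-1) k n = -altHarmonic k n := by
  rw [signHarmonic, altHarmonic, ← sum_neg_distrib]
  refine sum_congr rfl fun j _ => ?_
  rw [signChar_neg_one]
  push_cast
  ring

theorem signHarmonic_succ (ε : ℤˣ) (k n : ℕ) : signHarmonic ε k (n + 1)
    = signHarmonic ε k n + signChar ε (n + 1 : ℕ) / ((n + 1 : ℕ) : ℝ) ^ k := by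
  rw [signHarmonic, sum_range_succ, signHarmonic]

theorem signHarmonic_add (ε : ℤˣ) (k m n : ℕ) : signHarmonic ε k (m + n) = signHarmonic ε k m
    + signChar ε m * ∑ j ∈ range n, signChar ε (j + 1 : ℕ) / ((m + (j + 1) : ℕ) : ℝ) ^ k := by
  rw [signHarmonic, sum_range_add, signHarmonic, mul_sum]
  congr! 2 with j
  rw [add_assoc, Nat.cast_add, signChar_add, mul_div_assoc]

theorem abs_signHarmonic_le (ε : ℤˣ) {k : ℕ} (hk : 1 ≤ k) (n : ℕ) :
    |signHarmonic ε k n| ≤ genHarmonic 1 n := by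
  refine (abs_sum_le_sum_abs _ _).trans (sum_le_sum fun j _ => ?_)
  rw [abs_div, abs_signChar, abs_of_nonneg (by positivity), Nat.cast_add_one]
  gcongr
  exact le_add_of_nonneg_left j.cast_nonneg

theorem signHarmonic_two_mul_add (k n : ℕ) :
    signHarmonic 1 k (2 * n) + signHarmonic (-1) k (2 * n) = 2 / 2 ^ k * signHarmonic 1 k n := by
  induction n with
  | zero => simp [signHarmonic]
  | succ n ih =>
    rw [show 2 * (n + 1) = 2 * n + 1 + 1 by ring]
    simp only [signHarmonic_succ, signChar_one, signChar_neg_one, mul_add, ← ih, pow_succ, pow_mul]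
    push_cast
    rw [show 2 * (n : ℝ) + 1 + 1 = 2 * (n + 1) by ring, mul_pow]
    norm_num
    ring

theorem hasSum_signZeta (ε : ℤˣ) {k : ℕ} (hk : 2 ≤ k) :
    HasSum (fun n : ℕ => signChar ε (n + 1 : ℕ) / ((n + 1 : ℕ) : ℝ) ^ k) (signZeta ε k) := by
  have summable_one_div : Summable fun n : ℕ => 1 / ((n + 1 : ℕ) : ℝ) ^ k :=
    (summable_nat_add_iff 1).2 (Real.summable_one_div_nat_pow.2 hk)
  refine (summable_one_div.of_norm_bounded fun n => ?_).hasSum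
  rw [norm_div, Real.norm_eq_abs, abs_signChar, norm_pow, Real.norm_natCast]

theorem tendsto_signHarmonic (ε : ℤˣ) {k : ℕ} (hk : 2 ≤ k) :
    Tendsto (signHarmonic ε k) atTop (𝓝 (signZeta ε k)) :=
  (hasSum_signZeta ε hk).tendsto_sum_nat

theorem tendsto_two_mul_atTop : Tendsto (fun n : ℕ => 2 * n) atTop atTop :=
  tendsto_id.const_mul_atTop' two_pos

theorem signZeta_one (k : ℕ) : signZeta 1 k = zetaValue k := by
  simp [signZeta, zetaValue, signChar_one]

theorem signZeta_neg_one {k : ℕ} (hk : 2 ≤ k) :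
    signZeta (-1) k = (2 / 2 ^ k - 1) * zetaValue k := by
  have even_terms := ((tendsto_signHarmonic 1 hk).comp tendsto_two_mul_atTop).add
    ((tendsto_signHarmonic (-1) hk).comp tendsto_two_mul_atTop)
  have limit := tendsto_nhds_unique even_terms
    (((tendsto_signHarmonic 1 hk).const_mul (2 / 2 ^ k)).congr fun n =>
      (signHarmonic_two_mul_add k n).symm)
  rw [signZeta_one] at limit
  linarith

theorem tendsto_signHarmonic_neg_one_one :
    Tendsto (signHarmonic (-1) 1) atTop (𝓝 (-Real.log 2)) := by
  have even_terms : Tendsto (fun n => signHarmonic (-1) 1 (2 * n)) atTop (𝓝 (-Real.log 2)) := by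
    have asymptotic := Real.tendsto_harmonic_sub_log
    have difference :=
      (asymptotic.sub (asymptotic.comp tendsto_two_mul_atTop)).sub_const (Real.log 2)
    rw [sub_self, zero_sub] at difference
    refine difference.congr' ?_
    filter_upwards [eventually_gt_atTop 0] with n hn
    have split := signHarmonic_two_mul_add 1 n
    rw [signHarmonic_one, signHarmonic_one, genHarmonic_one, genHarmonic_one] at split
    simp only [Function.comp_apply]
    rw [Nat.cast_mul, Nat.cast_two, Real.log_mul two_ne_zero (by positivity)]
    linarith
  obtain ⟨l, hl⟩ := Antitone.tendsto_alternating_series_of_tendsto_zero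
    (f := fun n : ℕ => 1 / ((n : ℝ) + 1))
    (fun m n hmn => by
      dsimp only
      gcongr)
    tendsto_one_div_add_atTop_nhds_zero_nat
  have convergent : Tendsto (signHarmonic (-1) 1) atTop (𝓝 (-l)) := by
    refine hl.neg.congr fun n => ?_
    simp only [signHarmonic_neg_one, altHarmonic, mul_one_div, pow_one]
  rwa [tendsto_nhds_unique (convergent.comp tendsto_two_mul_atTop) even_terms] at convergent

theorem tendsto_signHarmonic_shift (ε : ℤˣ) (n : ℕ) :
    Tendsto (fun N => signChar ε n * signHarmonic ε 1 N - signHarmonic ε 1 (N + n)) atTop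
      (𝓝 ((1 - signChar ε n) * Real.log 2)) := by
  rcases Int.units_eq_one_or ε with rfl | rfl
  · have tail : Tendsto (fun N : ℕ => ∑ j ∈ range n, 1 / ((N + (j + 1) : ℕ) : ℝ)) atTop (𝓝 0) := by
      rw [← sum_const_zero (s := range n)]
      exact tendsto_finsetSum _ fun j _ =>
        (tendsto_add_atTop_iff_nat (j + 1)).2 tendsto_one_div_atTop_nhds_zero_nat
    simpa [signChar_one, signHarmonic_add] using tail.neg
  · have limit := tendsto_signHarmonic_neg_one_one
    convert (limit.const_mul (signChar (-1) n)).sub ((tendsto_add_atTop_iff_nat n).2 limit) using 2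
    ring

theorem exists_abs_signHarmonic_shift_le (ε : ℤˣ) : ∃ C, ∀ N n : ℕ, 1 ≤ n →
    |signChar ε n * signHarmonic ε 1 N - signHarmonic ε 1 (N + n)| ≤ C * genHarmonic 1 n := by
  rcases Int.units_eq_one_or ε with rfl | rfl
  · refine ⟨1, fun N n _ => ?_⟩
    rw [signHarmonic_add, signChar_one, signChar_one, one_mul, one_mul, sub_add_cancel_left,
      abs_neg, one_mul]
    refine (abs_sum_le_sum_abs _ _).trans (sum_le_sum fun j _ => ?_)
    rw [abs_of_nonneg (by rw [signChar_one]; positivity), signChar_one]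
    gcongr
    push_cast
    exact le_add_of_nonneg_left N.cast_nonneg
  · obtain ⟨C, hC⟩ := tendsto_signHarmonic_neg_one_one.abs.bddAbove_range
    refine ⟨C + C, fun N n hn => ?_⟩
    have hC (N) : |signHarmonic (-1) 1 N| ≤ C := hC ⟨N, rfl⟩
    have hC0 : 0 ≤ C := (abs_nonneg _).trans (hC 0)
    calc |signChar (-1) n * signHarmonic (-1) 1 N - signHarmonic (-1) 1 (N + n)|
        ≤ |signChar (-1) n * signHarmonic (-1) 1 N| + |signHarmonic (-1) 1 (N + n)| := abs_sub _ _
      _ ≤ C + C := by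
        rw [abs_mul, abs_signChar, one_mul]
        exact add_le_add (hC _) (hC _)
      _ ≤ (C + C) * genHarmonic 1 n :=
        le_mul_of_one_le_right (by positivity) (one_le_genHarmonic 1 hn)

/-! ### The digamma and cotangent kernels -/

/-- The sum `∑_{j=1}^N ε ^ j / (j - z) ^ e` with the undefined term `j = z` omitted, for `e ≥ 1`. -/
noncomputable def signFractionSum (ε : ℤˣ) (e : ℕ) (z : ℤ) (N : ℕ) : ℝ :=
  ∑ j ∈ range N, signChar ε (j + 1 : ℕ) * poleFraction z (j + 1 : ℕ) ^ e

theorem signFractionSum_zero (ε : ℤˣ) (e N : ℕ) :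
    signFractionSum ε e 0 N = signHarmonic ε e N := by
  simp [signFractionSum, signHarmonic, poleFraction, div_eq_mul_inv]

theorem signFractionSum_neg (ε : ℤˣ) (e n N : ℕ) : signFractionSum ε e (-n) N
    = signChar ε n * (signHarmonic ε e (n + N) - signHarmonic ε e n) := by
  rw [signHarmonic_add, add_sub_cancel_left, ← mul_assoc, signChar_mul_self, one_mul,
    signFractionSum]
  refine sum_congr rfl fun j _ => ?_
  rw [poleFraction, one_div_pow, mul_one_div]
  push_cast
  rw [sub_neg_eq_add, add_comm (n : ℝ)]

theorem signFractionSum_succ (ε : ℤˣ) {e : ℕ} (he : e ≠ 0) (p r : ℕ) :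
    signFractionSum ε e (p + 1 : ℕ) (p + 1 + r)
      = signChar ε (p + 1 : ℕ) * (signHarmonic ε e r + (-1) ^ e * signHarmonic ε e p) := by
  have below : ∑ j ∈ range p, signChar ε (j + 1 : ℕ) * poleFraction (p + 1 : ℕ) (j + 1 : ℕ) ^ e
      = signChar ε (p + 1 : ℕ) * ((-1) ^ e * signHarmonic ε e p) := by
    rw [← sum_range_reflect, signHarmonic, mul_sum, mul_sum]
    refine sum_congr rfl fun j hj => ?_
    obtain ⟨i, rfl⟩ := Nat.exists_eq_add_of_lt (mem_range.1 hj)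
    rw [show j + i + 1 - 1 - j = i by omega, poleFraction,
      show ((j + i + 1 + 1 : ℕ) : ℤ) = (i + 1 : ℕ) + (j + 1 : ℕ) by push_cast; ring, signChar_add,
      Int.cast_add, sub_add_cancel_left, one_div_neg_eq_neg_one_div, neg_pow, one_div_pow]
    push_cast
    linear_combination (-1) ^ e * (-signChar ε (i + 1) / ((j : ℝ) + 1) ^ e)
      * signChar_mul_self ε (j + 1)
  have above : ∑ j ∈ range r, signChar ε (p + 1 + j + 1 : ℕ)
        * poleFraction (p + 1 : ℕ) (p + 1 + j + 1 : ℕ) ^ e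
      = signChar ε (p + 1 : ℕ) * signHarmonic ε e r := by
    rw [signHarmonic, mul_sum]
    refine sum_congr rfl fun j _ => ?_
    rw [add_assoc (p + 1), Nat.cast_add (p + 1), signChar_add, poleFraction, Int.cast_add,
      add_sub_cancel_left, one_div_pow, mul_assoc, mul_one_div, Int.cast_natCast]
  rw [signFractionSum, sum_range_add, sum_range_succ, below, above, poleFraction_self,
    zero_pow he]
  ring

theorem HarmonicDominated.of_tendsto_comp {x : ℕ → ℝ} {l : ℝ} (hx : Tendsto x atTop (𝓝 l))
    {φ : ℕ → ℕ → ℕ} (hφ : ∀ n, Tendsto (fun N => φ N n) atTop atTop) :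
    HarmonicDominated 0 (fun N n => x (φ N n)) fun _ => l := by
  obtain ⟨C, hC⟩ := hx.abs.bddAbove_range
  exact ⟨fun n _ => hx.comp (hφ n), C, fun N n _ _ => by simpa using hC ⟨φ N n, rfl⟩⟩

theorem harmonicDominated_signChar (ε : ℤˣ) :
    HarmonicDominated 0 (fun _ n => signChar ε n) fun n => signChar ε n :=
  .of_bounded fun _ _ => (abs_signChar ε _).le

theorem harmonicDominated_inv_pow (e : ℕ) :
    HarmonicDominated 0 (fun _ n => 1 / (n : ℝ) ^ e) fun n => 1 / (n : ℝ) ^ e :=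
  .of_bounded (C := 1) fun n hn => by
    have hn : (1 : ℝ) ≤ n := by exact_mod_cast hn
    rw [abs_of_nonneg (by positivity)]
    exact div_le_one_of_le₀ (one_le_pow₀ hn) (by positivity)

theorem harmonicDominated_signHarmonic (ε : ℤˣ) {k : ℕ} (hk : 1 ≤ k) :
    HarmonicDominated 1 (fun _ n => signHarmonic ε k n) fun n => signHarmonic ε k n :=
  ⟨fun _ _ => tendsto_const_nhds, 1, fun _ n _ _ => by
    simpa using abs_signHarmonic_le ε hk n⟩

theorem harmonicDominated_signHarmonic_of_two_le (ε : ℤˣ) {k : ℕ} (hk : 2 ≤ k) :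
    HarmonicDominated 0 (fun _ n => signHarmonic ε k n) fun n => signHarmonic ε k n := by
  obtain ⟨C, hC⟩ := (tendsto_signHarmonic ε hk).abs.bddAbove_range
  exact .of_bounded fun n _ => hC ⟨n, rfl⟩

theorem harmonicDominated_signHarmonic_shift (ε : ℤˣ) {φ : ℕ → ℕ → ℕ}
    (hφ : ∀ n, Tendsto (fun N => φ N n) atTop atTop) :
    HarmonicDominated 1
      (fun N n => signChar ε n * signHarmonic ε 1 (φ N n) - signHarmonic ε 1 (φ N n + n))
      fun n => (1 - signChar ε n) * Real.log 2 := by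
  obtain ⟨C, hC⟩ := exists_abs_signHarmonic_shift_le ε
  exact ⟨fun n _ => (tendsto_signHarmonic_shift ε n).comp (hφ n), C, fun N n hn _ => by
    simpa using hC (φ N n) n hn⟩

/-- The limit as `N → ∞` of `-∑_{j=1}^N ε ^ j / j + ∑_{j=1}^N ε ^ j / (j + n)`. -/
noncomputable def digammaValue (ε : ℤˣ) (n : ℕ) : ℝ :=
  (1 - signChar ε n) * Real.log 2 - signChar ε n * signHarmonic ε 1 n

theorem harmonicDominated_digamma_neg (ε : ℤˣ) :
    HarmonicDominated 1 (fun N n => -signHarmonic ε 1 N + signFractionSum ε 1 (-n) N)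
      fun n => digammaValue ε n := by
  have shift := harmonicDominated_signHarmonic_shift ε (φ := fun N _ => N) fun _ => tendsto_id
  refine ((((harmonicDominated_signChar ε).mul shift).const_mul (-1)).sub
    ((harmonicDominated_signChar ε).mul (harmonicDominated_signHarmonic ε le_rfl))).congr
    (fun N n _ _ => ?_) fun n _ => ?_
  · rw [signFractionSum_neg, add_comm n N]
    linear_combination -signHarmonic ε 1 N * signChar_mul_self ε n
  · rw [digammaValue]
    linear_combination Real.log 2 * signChar_mul_self ε n

theorem harmonicDominated_digamma_pos (ε : ℤˣ) :
    HarmonicDominated 1 (fun N n => -signHarmonic ε 1 N + signFractionSum ε 1 n N)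
      fun n => digammaValue ε n + 1 / n := by
  have shift := harmonicDominated_signHarmonic_shift ε tendsto_sub_atTop_nat
  refine ((shift.sub ((harmonicDominated_signChar ε).mul
    (harmonicDominated_signHarmonic ε le_rfl))).add
      ((harmonicDominated_inv_pow 1).mono zero_le_one)).congr
    (fun N n hn hN => ?_) fun n _ => ?_
  · obtain ⟨p, rfl⟩ := Nat.exists_eq_add_of_le' hn
    obtain ⟨r, rfl⟩ := Nat.exists_eq_add_of_le hN
    rw [signFractionSum_succ ε one_ne_zero, Nat.add_sub_cancel_left, add_comm r, signHarmonic_succ]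
    linear_combination (-1 / ((p + 1 : ℕ) : ℝ) ^ 1) * signChar_mul_self ε (p + 1 : ℕ)
  · rw [digammaValue, pow_one]

theorem harmonicDominated_trigamma_neg (ε : ℤˣ) :
    HarmonicDominated 0 (fun N n => signFractionSum ε 2 (-n) N)
      fun n => signChar ε n * (signZeta ε 2 - signHarmonic ε 2 n) := by
  have tail := HarmonicDominated.of_tendsto_comp (tendsto_signHarmonic ε le_rfl)
    (φ := fun N n => n + N) fun n => tendsto_atTop_mono (fun _ => Nat.le_add_left _ n) tendsto_id
  refine ((harmonicDominated_signChar ε).mul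
    (tail.sub (harmonicDominated_signHarmonic_of_two_le ε le_rfl))).congr
    (fun N n _ _ => ?_) fun _ _ => rfl
  rw [signFractionSum_neg]

theorem harmonicDominated_trigamma_pos (ε : ℤˣ) :
    HarmonicDominated 0 (fun N n => signFractionSum ε 2 n N)
      fun n => signChar ε n * (signZeta ε 2 + signHarmonic ε 2 n) - 1 / (n : ℝ) ^ 2 := by
  have tail := HarmonicDominated.of_tendsto_comp (tendsto_signHarmonic ε le_rfl)
    tendsto_sub_atTop_nat
  refine (((harmonicDominated_signChar ε).mul
    (tail.add (harmonicDominated_signHarmonic_of_two_le ε le_rfl))).sub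
      (harmonicDominated_inv_pow 2)).congr (fun N n hn hN => ?_) fun _ _ => rfl
  obtain ⟨p, rfl⟩ := Nat.exists_eq_add_of_le' hn
  obtain ⟨r, rfl⟩ := Nat.exists_eq_add_of_le hN
  rw [signFractionSum_succ ε two_ne_zero, Nat.add_sub_cancel_left, signHarmonic_succ]
  linear_combination (1 / ((p + 1 : ℕ) : ℝ) ^ 2) * signChar_mul_self ε (p + 1 : ℕ)

/-- The truncation `∑_{k=1}^N ε ^ k (1 / (k - s) - 1 / k)` of `-γ - ψ(1 - s)`, twisted by the
sign `ε`. -/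
noncomputable def digammaKernel (ε : ℤˣ) (N : ℕ) : PolarSum ℝ ℤ :=
  ⟨-signHarmonic ε 1 N, fun k => if 0 < k then signChar ε k else 0⟩

/-- The truncation `∑_{0 < |k| ≤ N} ε ^ k / (k - s)` of `1 / s - π cot (π s)` for `ε = 1`, and of
`1 / s - π / sin (π s)` for `ε = -1`. -/
noncomputable def cotangentKernel (ε : ℤˣ) : PolarSum ℝ ℤ :=
  ⟨0, signChar ε⟩

/-- The Taylor series at `0` of the limit of the truncations `digammaKernel ε N`. -/
noncomputable def digammaSeries (ε : ℤˣ) : PowerSeries ℝ :=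
  PowerSeries.mk fun j => if j = 0 then 0 else signZeta ε (j + 1)

/-- The Taylor series at `0` of the limit of the truncations of `cotangentKernel ε`. -/
noncomputable def cotangentSeries (ε : ℤˣ) : PowerSeries ℝ :=
  PowerSeries.mk fun j => (1 + (-1) ^ (j + 1)) * signZeta ε (j + 1)

theorem sum_digammaKernel (ε : ℤˣ) (e N : ℕ) (z : ℤ) :
    ∑ k ∈ punctured N, (digammaKernel ε N).residue k * poleFraction z k ^ e
      = signFractionSum ε e z N := by
  rw [sum_punctured, signFractionSum]
  refine sum_congr rfl fun n _ => ?_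
  simp only [digammaKernel]
  rw [if_pos (by omega), if_neg (by omega), zero_mul, add_zero]

theorem poleFraction_neg (z k : ℤ) : poleFraction z (-k) = -poleFraction (-z) k := by
  rw [poleFraction, poleFraction, ← one_div_neg_eq_neg_one_div]
  push_cast
  ring_nf

theorem sum_cotangentKernel (ε : ℤˣ) (e N : ℕ) (z : ℤ) :
    ∑ k ∈ punctured N, (cotangentKernel ε).residue k * poleFraction z k ^ e
      = signFractionSum ε e z N + (-1) ^ e * signFractionSum ε e (-z) N := by
  rw [sum_punctured, signFractionSum, signFractionSum, mul_sum, ← sum_add_distrib]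
  refine sum_congr rfl fun n _ => ?_
  simp only [cotangentKernel]
  rw [signChar_neg, poleFraction_neg, neg_pow]
  ring

theorem jet_digammaKernel (ε : ℤˣ) (N : ℕ) (z : ℤ) :
    (digammaKernel ε N).jet (punctured N) poleFraction z = ⟨if 0 < z then signChar ε z else 0,
      -signHarmonic ε 1 N + signFractionSum ε 1 z N, signFractionSum ε 2 z N⟩ := by
  simp only [PolarSum.jet, PolarSum.eval, PolarSum.slope, ← sum_digammaKernel, pow_one,
    digammaKernel]

theorem jet_cotangentKernel (ε : ℤˣ) (N : ℕ) (z : ℤ) :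
    (cotangentKernel ε).jet (punctured N) poleFraction z = ⟨signChar ε z,
      signFractionSum ε 1 z N - signFractionSum ε 1 (-z) N,
      signFractionSum ε 2 z N + signFractionSum ε 2 (-z) N⟩ := by
  have value := sum_cotangentKernel ε 1 N z
  have slope := sum_cotangentKernel ε 2 N z
  simp only [pow_one, neg_one_mul, ← sub_eq_add_neg] at value
  rw [neg_one_sq, one_mul] at slope
  rw [PolarSum.jet, PolarSum.eval, PolarSum.slope, value, slope, cotangentKernel, zero_add]

/-- The Laurent data at `n` of the limit of the truncations `digammaKernel ε N`. -/
noncomputable def digammaJetPos (ε : ℤˣ) (n : ℕ) : LaurentJet ℝ :=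
  ⟨signChar ε n, digammaValue ε n + 1 / n,
    signChar ε n * (signZeta ε 2 + signHarmonic ε 2 n) - 1 / (n : ℝ) ^ 2⟩

/-- The Laurent data at `-n` of the limit of the truncations `digammaKernel ε N`. -/
noncomputable def digammaJetNeg (ε : ℤˣ) (n : ℕ) : LaurentJet ℝ :=
  ⟨0, digammaValue ε n, signChar ε n * (signZeta ε 2 - signHarmonic ε 2 n)⟩

theorem tendstoKernel_digammaKernel (ε : ℤˣ) : PolarSum.TendstoKernel (digammaKernel ε)
    (digammaJetPos ε) (digammaJetNeg ε) (digammaSeries ε) where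
  pos := by
    simp only [jet_digammaKernel]
    exact ⟨(harmonicDominated_signChar ε).congr
        (fun N n hn _ => (if_pos (Int.natCast_pos.2 hn)).symm) fun _ _ => rfl,
      harmonicDominated_digamma_pos ε, harmonicDominated_trigamma_pos ε⟩
  neg := by
    simp only [jet_digammaKernel]
    exact ⟨(HarmonicDominated.of_bounded (C := 0) fun _ _ => abs_zero.le).congr
        (fun N n hn _ => (if_neg (by omega)).symm) fun _ _ => rfl,
      harmonicDominated_digamma_neg ε, harmonicDominated_trigamma_neg ε⟩
  coeff j := by
    simp only [PolarSum.coeff_series, sum_digammaKernel, signFractionSum_zero, digammaSeries,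
      PowerSeries.coeff_mk]
    rcases Nat.eq_zero_or_pos j with rfl | hj
    · simp [digammaKernel]
    · simpa only [if_neg hj.ne', zero_add] using tendsto_signHarmonic ε (Nat.succ_le_succ hj)

/-- The Laurent data at `s n`, for a sign `s`, of the limit of the truncations of
`cotangentKernel ε`. -/
noncomputable def cotangentJet (ε : ℤˣ) (s : ℝ) (n : ℕ) : LaurentJet ℝ :=
  ⟨signChar ε n, s / n, 2 * signChar ε n * signZeta ε 2 - 1 / (n : ℝ) ^ 2⟩

theorem tendstoKernel_cotangentKernel (ε : ℤˣ) : PolarSum.TendstoKernel (fun _ => cotangentKernel ε)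
    (cotangentJet ε 1) (cotangentJet ε (-1)) (cotangentSeries ε) where
  pos := by
    simp only [jet_cotangentKernel]
    refine ⟨harmonicDominated_signChar ε,
      ((harmonicDominated_digamma_pos ε).sub (harmonicDominated_digamma_neg ε)).congr
        (fun N n _ _ => by ring) fun n _ => by rw [cotangentJet]; ring,
      ((harmonicDominated_trigamma_pos ε).add (harmonicDominated_trigamma_neg ε)).congr
        (fun N n _ _ => rfl) fun n _ => by rw [cotangentJet]; ring⟩
  neg := by
    simp only [jet_cotangentKernel, neg_neg, signChar_neg]
    refine ⟨harmonicDominated_signChar ε,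
      ((harmonicDominated_digamma_neg ε).sub (harmonicDominated_digamma_pos ε)).congr
        (fun N n _ _ => by ring) fun n _ => by rw [cotangentJet]; ring,
      ((harmonicDominated_trigamma_neg ε).add (harmonicDominated_trigamma_pos ε)).congr
        (fun N n _ _ => rfl) fun n _ => by rw [cotangentJet]; ring⟩
  coeff j := by
    simp only [PolarSum.coeff_series, sum_cotangentKernel, signFractionSum_zero, cotangentSeries,
      PowerSeries.coeff_mk, neg_zero, ← one_add_mul]
    rcases Nat.eq_zero_or_pos j with rfl | hj
    · simp [cotangentKernel]
    · simpa only [if_neg hj.ne', zero_add] using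
        (tendsto_signHarmonic ε (Nat.succ_le_succ hj)).const_mul _

/-! ### Reducibility to linear sums -/

/-- The rational span of the monomials of weight `w` in `ln 2` and zeta values. -/
noncomputable def monomialSpan (w : ℕ) : Submodule ℚ ℝ :=
  Submodule.span ℚ {x | IsZetaLogMonomial w x}

theorem IsZetaLogMonomial.mul {u v : ℕ} {x y : ℝ} (hx : IsZetaLogMonomial u x)
    (hy : IsZetaLogMonomial v y) : IsZetaLogMonomial (u + v) (x * y) := by
  induction hy with
  | one => rwa [mul_one, add_zero]
  | mul_log _ ih =>
    rw [← add_assoc, ← mul_assoc]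
    exact ih.mul_log
  | mul_zeta k hk _ ih =>
    rw [← add_assoc, ← mul_assoc]
    exact ih.mul_zeta k hk

theorem monomialSpan_le (w : ℕ) : monomialSpan w ≤ reducibleToLinearSums w :=
  Submodule.span_mono Set.subset_union_left

theorem mul_mem_monomialSpan {u v : ℕ} {x y : ℝ} (hx : x ∈ monomialSpan u)
    (hy : y ∈ monomialSpan v) : x * y ∈ monomialSpan (u + v) := by
  have product := Submodule.mul_mem_mul hx hy
  rw [monomialSpan, monomialSpan, Submodule.span_mul_span] at product
  exact Submodule.span_mono (Set.mul_subset_iff.2 fun _ hx _ hy => hx.mul hy) product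

theorem mul_mem_reducibleToLinearSums {u v : ℕ} {x y : ℝ} (hx : x ∈ monomialSpan u)
    (hy : y ∈ reducibleToLinearSums v) : x * y ∈ reducibleToLinearSums (u + v) := by
  have product := Submodule.mul_mem_mul hx hy
  rw [monomialSpan, reducibleToLinearSums, Submodule.span_mul_span] at product
  refine Submodule.span_mono (Set.mul_subset_iff.2 fun x hx y hy => ?_) product
  rcases hy with hy | ⟨u', v', a, s, rfl, ha, hs, rfl⟩
  · exact Or.inl (IsZetaLogMonomial.mul hx hy)
  · exact Or.inr ⟨u + u', v', x * a, s, add_assoc _ _ _, IsZetaLogMonomial.mul hx ha, hs,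
      (mul_assoc _ _ _).symm⟩

theorem ratCast_mem_monomialSpan (r : ℚ) : (r : ℝ) ∈ monomialSpan 0 := by
  rw [← mul_one (r : ℝ), ← Rat.smul_def]
  exact Submodule.smul_mem _ r (Submodule.subset_span .one)

theorem log_two_mem_monomialSpan : Real.log 2 ∈ monomialSpan 1 :=
  Submodule.subset_span (by simpa using IsZetaLogMonomial.one.mul_log)

theorem signZeta_mem_monomialSpan (ε : ℤˣ) {k : ℕ} (hk : 2 ≤ k) :
    signZeta ε k ∈ monomialSpan k := by
  have zeta_mem : zetaValue k ∈ monomialSpan k :=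
    Submodule.subset_span (by simpa using IsZetaLogMonomial.one.mul_zeta k hk)
  rcases Int.units_eq_one_or ε with rfl | rfl
  · rwa [signZeta_one]
  · rw [signZeta_neg_one hk]
    simpa using mul_mem_monomialSpan (ratCast_mem_monomialSpan (2 / 2 ^ k - 1)) zeta_mem

/-- The `j`-th coefficient has weight `j + d` for every `j`. -/
def IsHomogeneousSeries (d : ℕ) (F : PowerSeries ℝ) : Prop :=
  ∀ j, PowerSeries.coeff j F ∈ monomialSpan (j + d)

theorem IsHomogeneousSeries.mul {d e : ℕ} {F G : PowerSeries ℝ} (hF : IsHomogeneousSeries d F)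
    (hG : IsHomogeneousSeries e G) : IsHomogeneousSeries (d + e) (F * G) := fun t => by
  rw [PowerSeries.coeff_mul]
  refine Submodule.sum_mem _ fun ij hij => ?_
  rw [← mem_antidiagonal.1 hij, add_add_add_comm]
  exact mul_mem_monomialSpan (hF ij.1) (hG ij.2)

theorem isHomogeneousSeries_digammaSeries (ε : ℤˣ) :
    IsHomogeneousSeries 1 (digammaSeries ε) := fun j => by
  rw [digammaSeries, PowerSeries.coeff_mk]
  split_ifs with hj
  · exact Submodule.zero_mem _
  · exact signZeta_mem_monomialSpan ε (by omega)

theorem isHomogeneousSeries_cotangentSeries (ε : ℤˣ) :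
    IsHomogeneousSeries 1 (cotangentSeries ε) := fun j => by
  rw [cotangentSeries, PowerSeries.coeff_mk]
  rcases Nat.eq_zero_or_pos j with rfl | hj
  · simp
  · have product := mul_mem_monomialSpan (ratCast_mem_monomialSpan (1 + (-1) ^ (j + 1)))
      (signZeta_mem_monomialSpan ε (Nat.succ_le_succ hj))
    rw [zero_add] at product
    exact_mod_cast product

namespace SeriesReducible

variable {u v w : ℕ} {f g : ℕ → ℝ} {c : ℝ}

theorem add (hf : SeriesReducible w f) (hg : SeriesReducible w g) :
    SeriesReducible w fun n => f n + g n := by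
  obtain ⟨S, hS, hf⟩ := hf
  obtain ⟨T, hT, hg⟩ := hg
  exact ⟨S + T, Submodule.add_mem _ hS hT, hf.add hg⟩

theorem const_mul (hc : c ∈ monomialSpan u) (hf : SeriesReducible v f) :
    SeriesReducible (u + v) fun n => c * f n := by
  obtain ⟨S, hS, hf⟩ := hf
  exact ⟨c * S, mul_mem_reducibleToLinearSums hc hS, hf.mul_left c⟩

theorem ratCast_mul (r : ℚ) (hf : SeriesReducible w f) : SeriesReducible w fun n => r * f n :=
  zero_add w ▸ hf.const_mul (ratCast_mem_monomialSpan r)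

theorem congr (hf : SeriesReducible w f) (h : ∀ n, 1 ≤ n → f n = g n) : SeriesReducible w g := by
  obtain ⟨S, hS, hf⟩ := hf
  refine ⟨S, hS, ?_⟩
  simpa only [h _ (Nat.succ_pos _)] using hf

theorem odd_terms (hf : SeriesReducible w f) (even_eq_zero : ∀ n, f (2 * n) = 0)
    (one_eq_zero : f 1 = 0) : SeriesReducible w fun n => f (2 * n + 1) := by
  obtain ⟨S, hS, hf⟩ := hf
  refine ⟨S, hS, ?_⟩
  have injective : Function.Injective fun n : ℕ => 2 * (n + 1) := fun m n h => by
    dsimp only at h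
    omega
  refine (injective.hasSum_iff fun n hn => ?_).2 hf
  rcases Nat.even_or_odd' n with ⟨_ | k, rfl | rfl⟩
  · exact one_eq_zero
  · exact even_eq_zero 1
  · exact absurd ⟨k, rfl⟩ hn
  · exact even_eq_zero (k + 1 + 1)

end SeriesReducible

/-- Reducibility in weight `w` of both `∑ n, f n` and `∑ n, (-1) ^ n * f n`, in a form closed under
multiplication of the terms by sign characters. -/
def TwistReducible (w : ℕ) (f : ℕ → ℝ) : Prop :=
  ∀ ρ : ℤˣ, SeriesReducible w fun n => signChar ρ n * f n

namespace TwistReducible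

variable {u v w : ℕ} {f g : ℕ → ℝ} {c : ℝ}

theorem seriesReducible (hf : TwistReducible w f) : SeriesReducible w f := by
  simpa only [signChar_one, one_mul] using hf 1

theorem signChar_mul (ε : ℤˣ) (hf : TwistReducible w f) :
    TwistReducible w fun n => signChar ε n * f n := fun ρ => by
  simpa only [_root_.signChar_mul, mul_assoc] using hf (ρ * ε)

theorem add (hf : TwistReducible w f) (hg : TwistReducible w g) :
    TwistReducible w fun n => f n + g n := fun ρ => by
  simpa only [mul_add] using (hf ρ).add (hg ρ)

theorem const_mul (hc : c ∈ monomialSpan u) (hf : TwistReducible v f) :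
    TwistReducible (u + v) fun n => c * f n := fun ρ => by
  simpa only [mul_left_comm c] using (hf ρ).const_mul hc

theorem ratCast_mul (r : ℚ) (hf : TwistReducible w f) : TwistReducible w fun n => r * f n :=
  zero_add w ▸ hf.const_mul (ratCast_mem_monomialSpan r)

theorem sub (hf : TwistReducible w f) (hg : TwistReducible w g) :
    TwistReducible w fun n => f n - g n := by
  simpa [sub_eq_add_neg] using hf.add (hg.ratCast_mul (-1))

end TwistReducible

theorem twistReducible_one_div_pow {q : ℕ} (hq : 2 ≤ q) :
    TwistReducible q fun n => 1 / (n : ℝ) ^ q := fun ρ => by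
  refine ⟨signZeta ρ q, monomialSpan_le q (signZeta_mem_monomialSpan ρ hq), ?_⟩
  simpa only [mul_one_div] using hasSum_signZeta ρ hq

theorem summable_signHarmonic_div_pow (ρ ε : ℤˣ) {p q : ℕ} (hp : 1 ≤ p) (hq : 2 ≤ q) :
    Summable fun n : ℕ =>
      signChar ρ (n + 1 : ℕ) * (signHarmonic ε p (n + 1) / ((n + 1 : ℕ) : ℝ) ^ q) := by
  have weighted := ((HarmonicDominated.sq_div_pow hq abs_one).mul
    (harmonicDominated_signChar ρ)).mul (harmonicDominated_signHarmonic ε hp)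
  exact ((weighted.mono one_le_two).congr (fun N n _ _ => by ring) fun n _ => by ring).summable
    (u := fun _ n => signChar ρ n * (signHarmonic ε p n / (n : ℝ) ^ q))
    (v := fun n => signChar ρ n * (signHarmonic ε p n / (n : ℝ) ^ q))

theorem tsum_signHarmonic_div_pow_mem (ρ ε : ℤˣ) {p q : ℕ} (hp : 1 ≤ p) (hq : 2 ≤ q) :
    ∑' n : ℕ, signChar ρ (n + 1 : ℕ) * (signHarmonic ε p (n + 1) / ((n + 1 : ℕ) : ℝ) ^ q)
      ∈ reducibleToLinearSums (p + q) := by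
  have mem {s : ℝ} (hs : IsLinearSum (p + q) s) : s ∈ reducibleToLinearSums (p + q) :=
    Submodule.subset_span (Or.inr ⟨0, p + q, 1, s, zero_add _, .one, hs, (one_mul s).symm⟩)
  rcases Int.units_eq_one_or ρ with rfl | rfl <;> rcases Int.units_eq_one_or ε with rfl | rfl <;>
  simp only [signChar_one, signChar_neg_one, signHarmonic_one, signHarmonic_neg_one]
  · convert mem (.harm p q hp hq) using 3
    push_cast
    ring
  · convert Submodule.neg_mem _ (mem (.alt p q hp hq)) using 1
    rw [← tsum_neg]
    refine tsum_congr fun n => ?_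
    push_cast
    ring
  · convert Submodule.neg_mem _ (mem (.harmAlt p q hp hq)) using 1
    rw [← tsum_neg]
    refine tsum_congr fun n => ?_
    push_cast
    ring
  · convert mem (.altAlt p q hp hq) using 3
    push_cast
    ring

theorem twistReducible_signHarmonic_div_pow (ε : ℤˣ) {p q : ℕ} (hp : 1 ≤ p) (hq : 2 ≤ q) :
    TwistReducible (p + q) fun n => signHarmonic ε p n / (n : ℝ) ^ q := fun ρ =>
  ⟨_, tsum_signHarmonic_div_pow_mem ρ ε hp hq, (summable_signHarmonic_div_pow ρ ε hp hq).hasSum⟩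

theorem twistReducible_digammaValue_div_pow (ε : ℤˣ) {q : ℕ} (hq : 2 ≤ q) :
    TwistReducible (q + 1) fun n => digammaValue ε n / (n : ℝ) ^ q := by
  have log := (twistReducible_one_div_pow hq).const_mul log_two_mem_monomialSpan
  have harmonic := twistReducible_signHarmonic_div_pow ε le_rfl hq
  rw [add_comm q]
  convert (log.sub (log.signChar_mul ε)).sub (harmonic.signChar_mul ε) using 2 with n
  rw [digammaValue]
  ring

theorem twistReducible_trigamma_div_pow (ε : ℤˣ) {q : ℕ} (hq : 2 ≤ q) :
    TwistReducible (q + 2)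
      fun n => signChar ε n * (signZeta ε 2 + signHarmonic ε 2 n) / (n : ℝ) ^ q := by
  have zeta := (twistReducible_one_div_pow hq).const_mul (signZeta_mem_monomialSpan ε le_rfl)
  have harmonic := twistReducible_signHarmonic_div_pow ε one_le_two hq
  rw [add_comm q]
  convert (zeta.add harmonic).signChar_mul ε using 2 with n
  ring

/-- The contribution of `ln 2` to the product of two digamma values in the residue sum. -/
noncomputable def logTerms (σ τ γ : ℤˣ) (q n : ℕ) : ℝ :=
  Real.log 2 * (signChar γ n * (digammaValue τ n / (n : ℝ) ^ q
    - signChar σ n * (digammaValue τ n / (n : ℝ) ^ q + signHarmonic σ 1 n / (n : ℝ) ^ q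
      - signChar τ n * (signHarmonic σ 1 n / (n : ℝ) ^ q))))

/-- The terms of the residue sum that are linear in the value or the slope of the digamma kernel
of `τ`, apart from those in `logTerms`. -/
noncomputable def mixedTerms (σ τ γ : ℤˣ) (q n : ℕ) : ℝ :=
  signChar σ n * (digammaValue τ n / (n : ℝ) ^ (q + 1))
    + signChar γ n * (digammaValue τ n / (n : ℝ) ^ (q + 1)
      + signChar σ n * (q * (digammaValue τ n / (n : ℝ) ^ (q + 1))
        - signChar τ n * (signZeta τ 2 + signHarmonic τ 2 n) / (n : ℝ) ^ q))

/-- The terms of the residue sum that involve no harmonic numbers. -/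
noncomputable def pureTerms (σ τ γ : ℤˣ) (q n : ℕ) : ℝ :=
  (signChar σ n + signChar τ n + signChar γ n + (q + 1) * (signChar σ n * signChar τ n
      + signChar σ n * signChar γ n + signChar τ n * signChar γ n)
    + q * (q + 1) / 2 * (signChar σ n * signChar τ n * signChar γ n)) * (1 / (n : ℝ) ^ (q + 2))
    - 2 * (signChar σ n * signChar τ n * signChar γ n) * (signZeta γ 2 * (1 / (n : ℝ) ^ q))

-- As `q` is even, the products of two digamma values at `n` and at `-n` add up; for odd `q` they
-- would cancel.
theorem tripleResidue_add_tripleResidue (σ τ γ : ℤˣ) {q : ℕ} (hq : Even q) (n : ℕ) :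
    tripleResidue q (1 * n) (digammaJetPos σ n) (digammaJetPos τ n) (cotangentJet γ 1 n)
      + tripleResidue q (-1 * n) (digammaJetNeg σ n) (digammaJetNeg τ n) (cotangentJet γ (-1) n)
    = 2 * (signChar (σ * τ * γ) n * (signHarmonic σ 1 n * signHarmonic τ 1 n / (n : ℝ) ^ q)
        + logTerms σ τ γ q n)
      + (mixedTerms σ τ γ q n + mixedTerms τ σ γ q n + pureTerms σ τ γ q n) := by
  simp only [tripleResidue, LaurentJet.simplePart, LaurentJet.doublePart, LaurentJet.triplePart,
    digammaJetPos, digammaJetNeg, cotangentJet, logTerms, mixedTerms, pureTerms, digammaValue,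
    signChar_mul, one_mul, neg_one_mul, hq.neg_pow]
  ring

theorem twistReducible_logTerms (σ τ γ : ℤˣ) {q : ℕ} (hq : 2 ≤ q) :
    TwistReducible (q + 2) (logTerms σ τ γ q) := by
  have digamma := twistReducible_digammaValue_div_pow τ hq
  have harmonic := twistReducible_signHarmonic_div_pow σ le_rfl hq
  rw [add_comm 1 q] at harmonic
  rw [show q + 2 = 1 + (q + 1) by ring]
  exact ((digamma.sub (((digamma.add harmonic).sub (harmonic.signChar_mul τ)).signChar_mul
    σ)).signChar_mul γ).const_mul log_two_mem_monomialSpan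

theorem twistReducible_mixedTerms (σ τ γ : ℤˣ) {q : ℕ} (hq : 2 ≤ q) :
    TwistReducible (q + 2) (mixedTerms σ τ γ q) := by
  have digamma : TwistReducible (q + 2) fun n => digammaValue τ n / (n : ℝ) ^ (q + 1) :=
    twistReducible_digammaValue_div_pow τ (Nat.le_succ_of_le hq)
  exact (digamma.signChar_mul σ).add ((digamma.add (((digamma.ratCast_mul q).sub
    (twistReducible_trigamma_div_pow τ hq)).signChar_mul σ)).signChar_mul γ)

theorem twistReducible_pureTerms (σ τ γ : ℤˣ) {q : ℕ} (hq : 2 ≤ q) :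
    TwistReducible (q + 2) (pureTerms σ τ γ q) := by
  have power : TwistReducible (q + 2) fun n => 1 / (n : ℝ) ^ (q + 2) :=
    twistReducible_one_div_pow (Nat.le_add_right_of_le hq)
  have zeta := (twistReducible_one_div_pow hq).const_mul (signZeta_mem_monomialSpan γ le_rfl)
  rw [add_comm 2 q] at zeta
  have linear := ((power.signChar_mul σ).add (power.signChar_mul τ)).add (power.signChar_mul γ)
  have bilinear := (((power.signChar_mul τ).signChar_mul σ).add
    ((power.signChar_mul γ).signChar_mul σ)).add ((power.signChar_mul γ).signChar_mul τ)
  have trilinear := (((power.ratCast_mul (q * (q + 1) / 2)).sub (zeta.ratCast_mul 2)).signChar_mul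
    γ).signChar_mul τ
  convert (linear.add (bilinear.ratCast_mul (q + 1))).add (trilinear.signChar_mul σ) using 2 with n
  rw [pureTerms]
  push_cast
  ring

theorem seriesReducible_tripleResidue (σ τ γ : ℤˣ) {q : ℕ} (hq : 2 ≤ q) :
    SeriesReducible (q + 2) fun n =>
      tripleResidue q (1 * n) (digammaJetPos σ n) (digammaJetPos τ n) (cotangentJet γ 1 n)
      + tripleResidue q (-1 * n) (digammaJetNeg σ n) (digammaJetNeg τ n)
        (cotangentJet γ (-1) n) := by
  obtain ⟨t, rfl⟩ := Nat.exists_eq_add_of_le' (one_le_two.trans hq)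
  exact ⟨_, monomialSpan_le _ (((isHomogeneousSeries_digammaSeries σ).mul
    (isHomogeneousSeries_digammaSeries τ)).mul (isHomogeneousSeries_cotangentSeries γ) t),
    PolarSum.hasSum_tripleResidue (tendstoKernel_digammaKernel σ) (tendstoKernel_digammaKernel τ)
      (tendstoKernel_cotangentKernel γ) (Nat.le_of_succ_le_succ hq)⟩

theorem twistReducible_signHarmonic_mul_signHarmonic_div_pow (σ τ : ℤˣ) {q : ℕ} (hq : 2 ≤ q)
    (even : Even q) :
    TwistReducible (q + 2) fun n => signHarmonic σ 1 n * signHarmonic τ 1 n / (n : ℝ) ^ q :=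
  fun ρ => by
  obtain ⟨γ, rfl⟩ : ∃ γ, σ * τ * γ = ρ := ⟨_, mul_inv_cancel_left (σ * τ) ρ⟩
  have residues := seriesReducible_tripleResidue σ τ γ hq
  have remainder := (((twistReducible_mixedTerms σ τ γ hq).add
    (twistReducible_mixedTerms τ σ γ hq)).add (twistReducible_pureTerms σ τ γ hq)).seriesReducible
  have logs := (twistReducible_logTerms σ τ γ hq).seriesReducible
  convert ((residues.add (remainder.ratCast_mul (-1))).ratCast_mul (1 / 2)).add
    (logs.ratCast_mul (-1)) using 2 with n
  rw [tripleResidue_add_tripleResidue σ τ γ even]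
  push_cast
  ring

theorem signHarmonic_one_add_neg_one_odd (n : ℕ) :
    signHarmonic 1 1 (2 * n + 1) + signHarmonic (-1) 1 (2 * n + 1) = signHarmonic 1 1 n := by
  have split := signHarmonic_two_mul_add 1 n
  rw [pow_one, div_self two_ne_zero, one_mul] at split
  rw [← split, signHarmonic_succ, signHarmonic_succ, signChar_one, signChar_neg_one,
    (odd_two_mul_add_one n).neg_one_pow]
  ring

theorem seriesReducible_genHarmonic_sq_div_odd_pow {q : ℕ} (hq : 2 ≤ q) (even : Even q) :
    SeriesReducible (q + 2) fun n => genHarmonic 1 n ^ 2 / (2 * (n : ℝ) + 1) ^ q := by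
  have product (σ τ : ℤˣ) :=
    twistReducible_signHarmonic_mul_signHarmonic_div_pow σ τ hq even
  have square := ((product 1 1).add ((product 1 (-1)).ratCast_mul 2)).add (product (-1) (-1))
  have odd_part := (square.sub (square.signChar_mul (-1))).seriesReducible.ratCast_mul (1 / 2)
  convert odd_part.odd_terms (fun n => ?_) ?_ using 2 with n
  · rw [← signHarmonic_one, ← signHarmonic_one_add_neg_one_odd, signChar_neg_one,
      (odd_two_mul_add_one n).neg_one_pow]
    push_cast
    ring
  · rw [signChar_neg_one, (even_two_mul n).neg_one_pow]
    ring
  · norm_num [signHarmonic, signChar_one, signChar]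

theorem theorem3p5 (m : ℕ) (hm : 1 ≤ m) :
    SeriesReducible (2 * m + 2)
      (fun n => altHarmonic 1 n ^ 2 / (n : ℝ) ^ (2 * m) * (-1 : ℝ) ^ (n - 1)) ∧
    SeriesReducible (2 * m + 2)
      (fun n => (harmonic n : ℝ) * altHarmonic 1 n / (n : ℝ) ^ (2 * m)) ∧
    SeriesReducible (2 * m + 2)
      (fun n => (harmonic n : ℝ) * altHarmonic 1 n / (n : ℝ) ^ (2 * m) * (-1 : ℝ) ^ (n - 1)) ∧
    SeriesReducible (2 * m + 2)
      (fun n => (harmonic n : ℝ) ^ 2 / (n : ℝ) ^ (2 * m)) ∧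
    SeriesReducible (2 * m + 2)
      (fun n => (harmonic n : ℝ) ^ 2 / (n : ℝ) ^ (2 * m) * (-1 : ℝ) ^ (n - 1)) ∧
    SeriesReducible (2 * m + 2)
      (fun n => altHarmonic 1 n ^ 2 / (n : ℝ) ^ (2 * m)) ∧
    SeriesReducible (2 * m + 2)
      (fun n => (harmonic n : ℝ) ^ 2 / (2 * (n : ℝ) + 1) ^ (2 * m)) := by
  have hq : 2 ≤ 2 * m := by omega
  have product (σ τ : ℤˣ) :=
    twistReducible_signHarmonic_mul_signHarmonic_div_pow σ τ hq (even_two_mul m)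
  have sign {n : ℕ} (hn : 1 ≤ n) : signChar (-1) n = -(-1) ^ (n - 1) := by
    rw [signChar_neg_one, ← mul_pow_sub_one (Nat.ne_of_gt hn) (-1 : ℝ), neg_one_mul]
  simp only [← genHarmonic_one]
  refine ⟨((product (-1) (-1) (-1)).ratCast_mul (-1)).congr fun n hn => ?_,
    ((product 1 (-1) 1).ratCast_mul (-1)).congr fun n hn => ?_,
    (product 1 (-1) (-1)).congr fun n hn => ?_, (product 1 1 1).congr fun n hn => ?_,
    ((product 1 1 (-1)).ratCast_mul (-1)).congr fun n hn => ?_,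
    (product (-1) (-1) 1).congr fun n hn => ?_,
    seriesReducible_genHarmonic_sq_div_odd_pow hq (even_two_mul m)⟩ <;>
  · simp only [signHarmonic_one, signHarmonic_neg_one, signChar_one, sign hn, Rat.cast_neg,
      Rat.cast_one]
    ring
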